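/- Let $d\in\mathbb N$ and let $\mathcal X\subseteq\{0,1\}^d$ be an arm set; write $i\in x$ for $x_i=1$. In the semi-bandit problem with parameter $\theta\in\mathbb R^d$, in each round $t$ a (possibly randomized) policy $\pi$ chooses $x_t\in\mathcal X$ on the basis of the past arms and observations, and then observes $y_{t,i}=\theta_i+\eta_{t,i}$ for all $i\in x_t$, where the $\eta_t\sim\mathcal N(0,I)$ are independent. Let $R^\pi_\theta(T)=T\max_{x\in\mathcal X}x^\top\theta-\mathbb E_\theta\big[\sum_{t=1}^T x_t^\top\theta\big]$ be the expected regret. The policy $\pi$ is called consistent if $R^\pi_\theta(T)=o(T^p)$ as $T\to\infty$ for all $\theta\in\mathbb R^d$ and all $p>0$. **Theorem.** Let $\pi$ be a consistent policy and let $\theta\in\mathbb R^d$ be such that $\mathcal X$ has a unique optimal arm $x_*$, i.e. $x^\top\theta<x_*^\top\theta$ for all $x\in\mathcal X\setminus\{x_*\}$. Suppose that, with probability $1$ under $\theta$, every coordinate $i\in\{1,\dots,d\}$ is pulled at least once in the course of the interaction (i.e. $i\in x_t$ for some $t$). Let $\Delta_x=\theta^\top(x_*-x)$ and $G_T=\mathbb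 E_\theta\big[\sum_{t=1}^T\mathrm{diag}(x_tx_t^\top)\big]$ (which is invertible for all large $T$), where $\mathrm{diag}$ sets the off-diagonal entries to $0$, and write $\|v\|_A^2=v^\top A v$. Then, for every $x\in\mathcal X$, $$\limsup_{T\to\infty}\ \log(T)\,\|x\|_{G_T^{-1}}^2\le\frac{\Delta_x^2}{2}\qquad\text{and}\qquad \limsup_{T\to\infty}\ \log(T)\,\|x-x_*\|_{G_T^{-1}}^2\le\frac{\Delta_x^2}{2}.$$ Furthermore, $$\limsup_{T\to\infty}\frac{R^\pi_\theta(T)}{\log T}\ \ge\ c(\mathcal X,\theta),$$ where $$c(\mathcal X,\theta)=\inf_{\tau\in[0,\infty)^{\mathcal X}}\ \sum_{x\in\mathcal X}\tau_x\Delta_x\quad\text{subject to}\quad \sum_{i\in x}\frac{1}{\sum_{x'\in\mathcal X:\,i\in x'}\tau_{x'}}\le\frac{\Delta_x^2}{2}\quad\text{for all }x\in\mathcal X\setminus\{x_*\},$$ with the convention $1/0=\infty$. -/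

import Mathlib

open MeasureTheory ProbabilityTheory Filter Asymptotics
open scoped Matrix NNReal ENNReal Topology

namespace SemiBandit

noncomputable section

/-- Law of the feedback when arm `x ∈ {0,1}^d` is pulled under the parameter `θ`: for every
`i ∈ x` the learner sees `θ i + η i`, with `η ~ N(0, I)`; the unobserved coordinates carry the
uninformative value `0`. -/
def obsLaw {d : ℕ} (θ : Fin d → ℝ) (x : Fin d → ℝ) : Measure (Fin d → ℝ) :=
  Measure.pi fun i => if x i = 1 then gaussianReal (θ i) 1 else Measure.dirac 0

instance {d : ℕ} (θ x : Fin d → ℝ) : IsProbabilityMeasure (obsLaw θ x) := by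
  have h : ∀ i, IsProbabilityMeasure
      (if x i = 1 then gaussianReal (θ i) 1 else Measure.dirac (0 : ℝ)) := by
    intro i
    split_ifs <;> infer_instance
  unfold obsLaw
  infer_instance

/-- What is recorded in one round: the pulled arm and the feedback. -/
abbrev Round {d : ℕ} (𝒳 : Finset (Fin d → ℝ)) : Type := 𝒳 × (Fin d → ℝ)

/-- The feedback law as a kernel from arms to observations. -/
def obsKernel {d : ℕ} (𝒳 : Finset (Fin d → ℝ)) (θ : Fin d → ℝ) : Kernel 𝒳 (Fin d → ℝ) :=
  Kernel.ofFunOfCountable fun x => obsLaw θ x.1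

instance {d : ℕ} (𝒳 : Finset (Fin d → ℝ)) (θ : Fin d → ℝ) :
    IsMarkovKernel (obsKernel 𝒳 θ) :=
  ⟨fun x => inferInstanceAs (IsProbabilityMeasure (obsLaw θ x.1))⟩

/-- A (possibly randomized) policy over the arm set `𝒳`: a distribution for the first arm, and,
for each `n`, a distribution for the next arm given the rounds `0, …, n`. -/
structure Policy {d : ℕ} (𝒳 : Finset (Fin d → ℝ)) where
  first : Measure 𝒳
  isProbabilityMeasure_first : IsProbabilityMeasure first
  next : (n : ℕ) → Kernel ((_i : Finset.Iic n) → Round 𝒳) 𝒳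
  isMarkovKernel_next : ∀ n, IsMarkovKernel (next n)

attribute [instance] Policy.isProbabilityMeasure_first Policy.isMarkovKernel_next

namespace Policy

variable {d : ℕ} {𝒳 : Finset (Fin d → ℝ)}

/-- The law of the infinite sequence of rounds when `π` interacts with the instance `θ`. -/
def law (π : Policy 𝒳) (θ : Fin d → ℝ) : Measure (ℕ → Round 𝒳) :=
  Kernel.trajMeasure (X := fun _ => Round 𝒳) (π.first ⊗ₘ obsKernel 𝒳 θ)
    (fun n => π.next n ⊗ₖ Kernel.prodMkLeft _ (obsKernel 𝒳 θ))

instance (π : Policy 𝒳) (θ : Fin d → ℝ) : IsProbabilityMeasure (π.law θ) := by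
  unfold law
  infer_instance

/-- Expected regret after `T` rounds. -/
def regret (π : Policy 𝒳) (θ : Fin d → ℝ) (T : ℕ) : ℝ :=
  T * (⨆ x : 𝒳, x.1 ⬝ᵥ θ) - ∫ ω, ∑ t ∈ Finset.range T, (ω t).1.1 ⬝ᵥ θ ∂(π.law θ)

/-- On every instance, the expected regret is `o(T^p)` for every `p > 0`. -/
def Consistent (π : Policy 𝒳) : Prop :=
  ∀ θ : Fin d → ℝ, ∀ p : ℝ, 0 < p →
    (fun T : ℕ => π.regret θ T) =o[atTop] fun T : ℕ => (T : ℝ) ^ p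

/-- `G_T = E[∑ diag (x_t x_tᵀ)]`, the sum over the first `T` rounds. -/
def designMatrix (π : Policy 𝒳) (θ : Fin d → ℝ) (T : ℕ) : Matrix (Fin d) (Fin d) ℝ :=
  Matrix.of fun i j => ∫ ω, (∑ t ∈ Finset.range T,
    Matrix.diagonal (Matrix.diag (Matrix.vecMulVec (ω t).1.1 (ω t).1.1))) i j ∂(π.law θ)

end Policy

/-- `T_i`: the number of the first `T` rounds in which the pulled arm contains coordinate `i`. -/
def pullCount {d : ℕ} {𝒳 : Finset (Fin d → ℝ)} (T : ℕ) (i : Fin d) (ω : ℕ → Round 𝒳) : ℕ :=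
  ((Finset.range T).filter fun t => (ω t).1.1 i = 1).card

/-- `‖v‖_A² = vᵀ A v`. -/
def sqNorm {d : ℕ} (A : Matrix (Fin d) (Fin d) ℝ) (v : Fin d → ℝ) : ℝ := v ⬝ᵥ (A *ᵥ v)

/-- The gap of `x` relative to the optimal arm `xs`. -/
def gap {d : ℕ} (θ xs x : Fin d → ℝ) : ℝ := θ ⬝ᵥ (xs - x)

/-- The allocations `τ ∈ [0,∞)^𝒳` with `∑_{i ∈ x} 1 / ∑_{x' ∋ i} τ_{x'} ≤ Δ_x² / 2` for every
arm `x ≠ xs`, where `1 / 0 = ∞`. -/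
def feasible {d : ℕ} (𝒳 : Finset (Fin d → ℝ)) (θ xs : Fin d → ℝ) : Set (𝒳 → ℝ≥0) :=
  {τ | ∀ x ∈ 𝒳, x ≠ xs →
    ∑ i with x i = 1, (∑ x' : 𝒳 with x'.1 i = 1, (τ x' : ℝ≥0∞))⁻¹
      ≤ ENNReal.ofReal (gap θ xs x ^ 2 / 2)}

/-- The constant `c(𝒳, θ)`: the optimal value of `∑ τ_x Δ_x` over the feasible allocations. -/
def lowerBoundConst {d : ℕ} (𝒳 : Finset (Fin d → ℝ)) (θ xs : Fin d → ℝ) : EReal :=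
  ⨅ τ ∈ feasible 𝒳 θ xs, ((∑ x : 𝒳, (τ x : ℝ) * gap θ xs x.1 : ℝ) : EReal)

end

end SemiBandit

namespace SemiBandit

/-! The proof is a change-of-measure argument in the style of Lai and Robbins. Let `N_i(T)` be the
expected number of observations of coordinate `i`; since arms are 0/1 vectors, `G_T` is diagonal
with entries `N_i(T)`. The policy contributes the same factor to the law of the interaction under
`θ` and under `θ'`, so the likelihood ratio is a product of Gaussian ones (`lintegral_law_change`),
and the relative entropy of `T` rounds is `∑ N_i(T) (θ'_i - θ_i)² / 2`.

If some arm beats `x_*` under `θ'`, consistency makes `x_*` dominant under `θ` and rare under `θ'`.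
A Bretagnolle–Huber inequality (`exp_neg_information_le`) then forces this entropy to be at least
`(1 - p) log T - 2 log 2` for large `T`.

For `x ≠ x_*`, perturb `θ` on `I = x \ x_*` so that `x` overtakes `x_*` by a small `δ`. The cheapest
direction has weights proportional to `1 / N_i(T)` and costs `(Δ_x + δ)² / (2 S_T)`, where `S_T =
∑_{i ∈ I} 1 / N_i(T)`; hence `log T · S_T` is at most `Δ_x² / 2` in the limit. The coordinates of
`x_*` are observed linearly often and contribute nothing, so the bound extends to `x ∪ x_*`, whose
sum dominates both squared norms.

Finally, expected pull counts divided by `log T` and inflated by any `s > 1` are feasible for large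
`T`, with cost `s` times the regret over `log T`. This gives the bound by `c(𝒳, θ)`. -/

/-! ### Gaussian feedback: log-likelihood ratios of a single round -/

/-- The log-likelihood ratio of `N(b, 1)` with respect to `N(a, 1)`. -/
noncomputable def gaussianLLR (a b y : ℝ) : ℝ := (b - a) * (y - a) - (b - a) ^ 2 / 2

@[fun_prop]
lemma measurable_gaussianLLR (a b : ℝ) : Measurable (gaussianLLR a b) := by
  unfold gaussianLLR; fun_prop

lemma gaussianReal_eq_withDensity_gaussianLLR (a b : ℝ) :
    gaussianReal b 1 =
      (gaussianReal a 1).withDensity fun y => ENNReal.ofReal (Real.exp (gaussianLLR a b y)) := by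
  rw [gaussianReal_of_var_ne_zero _ one_ne_zero, gaussianReal_of_var_ne_zero _ one_ne_zero,
    ← withDensity_mul _ (measurable_gaussianPDF _ _) (by fun_prop)]
  congr 1
  ext y
  simp only [gaussianPDF, Pi.mul_apply]
  rw [← ENNReal.ofReal_mul (gaussianPDFReal_nonneg _ _ _)]
  congr 1
  simp only [gaussianPDFReal, gaussianLLR]
  rw [mul_assoc _ (Real.exp _) (Real.exp _), ← Real.exp_add]
  congr 2
  simp only [NNReal.coe_one]
  ring

lemma integrable_gaussianLLR (a b : ℝ) : Integrable (gaussianLLR a b) (gaussianReal a 1) := by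
  have h : Integrable (fun y : ℝ => y) (gaussianReal a 1) :=
    (memLp_id_gaussianReal (μ := a) (v := 1) 1).integrable le_rfl
  exact ((h.sub (integrable_const a)).const_mul _).sub (integrable_const _)

lemma integral_gaussianLLR (a b : ℝ) :
    ∫ y, gaussianLLR a b y ∂(gaussianReal a 1) = -((b - a) ^ 2 / 2) := by
  have h : Integrable (fun y : ℝ => y) (gaussianReal a 1) :=
    (memLp_id_gaussianReal (μ := a) (v := 1) 1).integrable le_rfl
  have h2 : Integrable (fun y : ℝ => y - a) (gaussianReal a 1) := h.sub (integrable_const a)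
  unfold gaussianLLR
  rw [integral_sub (h2.const_mul _) (integrable_const _), integral_const_mul,
    integral_sub h (integrable_const _), integral_id_gaussianReal]
  simp

/-- The product of the measures `ρ i • μ i` has density `∏ ρ i` with respect to that of `μ i`. -/
lemma pi_withDensity_eq {ι : Type*} [Fintype ι] {α : ι → Type*} [∀ i, MeasurableSpace (α i)]
    (μ : ∀ i, Measure (α i)) [∀ i, IsProbabilityMeasure (μ i)] (ρ : ∀ i, α i → ℝ≥0∞)
    (hρ : ∀ i, Measurable (ρ i)) [∀ i, SigmaFinite ((μ i).withDensity (ρ i))] :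
    Measure.pi (fun i => (μ i).withDensity (ρ i)) =
      (Measure.pi μ).withDensity fun y => ∏ i, ρ i (y i) := by
  refine Measure.pi_eq fun s hs => ?_
  rw [withDensity_apply _ (MeasurableSet.univ_pi hs), ← lintegral_indicator (.univ_pi hs)]
  have h1 : ∀ y : ∀ i, α i, (Set.univ.pi s).indicator (fun y => ∏ i, ρ i (y i)) y =
      ∏ i, (s i).indicator (ρ i) (y i) := by
    intro y
    by_cases hy : y ∈ Set.univ.pi s
    · rw [Set.indicator_of_mem hy]
      exact Finset.prod_congr rfl fun i _ =>
        (Set.indicator_of_mem (hy i (Set.mem_univ i)) _).symm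
    · rw [Set.indicator_of_notMem hy]
      simp only [Set.mem_pi, Set.mem_univ, true_implies, not_forall] at hy
      obtain ⟨i, hi⟩ := hy
      exact (Finset.prod_eq_zero (Finset.mem_univ i) (Set.indicator_of_notMem hi _)).symm
  simp_rw [h1]
  have hm : ∀ i, Measurable ((s i).indicator (ρ i)) := fun i => (hρ i).indicator (hs i)
  have hind := iIndepFun_pi (μ := μ) (X := fun i => (s i).indicator (ρ i))
    fun i => (hm i).aemeasurable
  rw [lintegral_prod_eq_prod_lintegral_of_indepFun Finset.univ
    (fun i (y : ∀ i, α i) => (s i).indicator (ρ i) (y i)) hind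
    fun i => (hm i).comp (measurable_pi_apply i)]
  refine Finset.prod_congr rfl fun i _ => ?_
  rw [withDensity_apply _ (hs i), ← lintegral_indicator (hs i)]
  exact (measurePreserving_eval μ i).lintegral_comp (hm i)

variable {d : ℕ} {𝒳 : Finset (Fin d → ℝ)}

/-- The log-likelihood ratio of one round under `θ'` with respect to `θ`. -/
noncomputable def roundLLR (θ θ' : Fin d → ℝ) (r : Round 𝒳) : ℝ :=
  ∑ i, if r.1.1 i = 1 then gaussianLLR (θ i) (θ' i) (r.2 i) else 0

lemma measurable_coe_arm : Measurable (fun r : Round 𝒳 => r.1.1) :=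
  measurable_subtype_coe.comp measurable_fst

lemma measurableSet_arm_coord (i : Fin d) : MeasurableSet {r : Round 𝒳 | r.1.1 i = 1} :=
  ((measurable_pi_apply i).comp measurable_coe_arm) (measurableSet_singleton 1)

@[fun_prop]
lemma measurable_roundLLR (θ θ' : Fin d → ℝ) :
    Measurable (roundLLR θ θ' : Round 𝒳 → ℝ) := by
  unfold roundLLR
  refine Finset.measurable_sum _ fun i _ => Measurable.ite (measurableSet_arm_coord i) ?_
    measurable_const
  fun_prop

/-- Unobserved coordinates are the same Dirac mass under both parameters, so only the coordinates in
`x` contribute to the density. -/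
lemma obsLaw_eq_withDensity (θ θ' : Fin d → ℝ) (x : 𝒳) :
    obsLaw θ' x.1 =
      (obsLaw θ x.1).withDensity fun y => ENNReal.ofReal (Real.exp (roundLLR θ θ' (x, y))) := by
  have hP : ∀ η : Fin d → ℝ, ∀ i, IsProbabilityMeasure
      (if x.1 i = 1 then gaussianReal (η i) 1 else Measure.dirac (0 : ℝ)) := by
    intro η i
    split_ifs <;> infer_instance
  have h1 : ∀ i, (if x.1 i = 1 then gaussianReal (θ' i) 1 else Measure.dirac (0 : ℝ)) =
      (if x.1 i = 1 then gaussianReal (θ i) 1 else Measure.dirac (0 : ℝ)).withDensity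
        (fun y => ENNReal.ofReal (Real.exp
          (if x.1 i = 1 then gaussianLLR (θ i) (θ' i) y else 0))) := by
    intro i
    split_ifs
    · exact gaussianReal_eq_withDensity_gaussianLLR _ _
    · simp
  have hP' := hP θ
  have hS : ∀ i, SigmaFinite ((if x.1 i = 1 then gaussianReal (θ i) 1
      else Measure.dirac (0 : ℝ)).withDensity (fun y => ENNReal.ofReal (Real.exp
          (if x.1 i = 1 then gaussianLLR (θ i) (θ' i) y else 0)))) := by
    intro i
    rw [← h1 i]
    have := hP θ' i
    infer_instance
  unfold obsLaw
  simp_rw [h1]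
  rw [pi_withDensity_eq]
  · congr 1
    ext y
    rw [← ENNReal.ofReal_prod_of_nonneg fun i _ => (Real.exp_pos _).le, ← Real.exp_sum]
    rfl
  · intro i
    split_ifs <;> fun_prop

lemma measurePreserving_obsLaw_eval (θ x : Fin d → ℝ) {i : Fin d} (h : x i = 1) :
    MeasurePreserving (fun y : Fin d → ℝ => y i) (obsLaw θ x) (gaussianReal (θ i) 1) := by
  have hP : ∀ i, IsProbabilityMeasure
      (if x i = 1 then gaussianReal (θ i) 1 else Measure.dirac (0 : ℝ)) := by
    intro i
    split_ifs <;> infer_instance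
  have := measurePreserving_eval
    (fun i => if x i = 1 then gaussianReal (θ i) 1 else Measure.dirac (0 : ℝ)) i
  rwa [if_pos h] at this

lemma integrable_gaussianLLR_obsLaw (θ θ' x : Fin d → ℝ) (i : Fin d) :
    Integrable (fun y => if x i = 1 then gaussianLLR (θ i) (θ' i) (y i) else 0) (obsLaw θ x) := by
  by_cases h : x i = 1
  · simp only [h, if_true]
    exact (measurePreserving_obsLaw_eval θ x h).integrable_comp_of_integrable
      (integrable_gaussianLLR _ _)
  · simp [h]

lemma integrable_roundLLR_obsLaw (θ θ' : Fin d → ℝ) (x : 𝒳) :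
    Integrable (fun y => roundLLR θ θ' (x, y)) (obsLaw θ x.1) :=
  integrable_finsetSum _ fun i _ => integrable_gaussianLLR_obsLaw θ θ' x.1 i

lemma integral_roundLLR_obsLaw (θ θ' : Fin d → ℝ) (x : 𝒳) :
    ∫ y, roundLLR θ θ' (x, y) ∂(obsLaw θ x.1) =
      -∑ i, if x.1 i = 1 then (θ' i - θ i) ^ 2 / 2 else 0 := by
  unfold roundLLR
  rw [integral_finsetSum _ fun i _ => integrable_gaussianLLR_obsLaw θ θ' x.1 i,
    ← Finset.sum_neg_distrib]
  refine Finset.sum_congr rfl fun i _ => ?_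
  by_cases h : x.1 i = 1
  · have hm := measurePreserving_obsLaw_eval θ x.1 h
    simp only [h, if_true]
    rw [← integral_gaussianLLR, ← hm.map_eq, integral_map hm.measurable.aemeasurable
      (measurable_gaussianLLR _ _).aestronglyMeasurable]
  · simp [h]

end SemiBandit

/-! ### The law of the interaction and its change of measure -/

lemma ProbabilityTheory.Kernel.map_zero_trajMeasure {X : ℕ → Type*} [∀ n, MeasurableSpace (X n)]
    (μ₀ : Measure (X 0)) (κ : (n : ℕ) → Kernel (Π i : Finset.Iic n, X i) (X (n + 1)))
    [∀ n, IsMarkovKernel (κ n)] :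
    (Kernel.trajMeasure μ₀ κ).map (fun ω => ω 0) = μ₀ := by
  have h1 : (fun ω : ∀ n, X n => ω 0) =
      (fun h : Π i : Finset.Iic 0, X i => h ⟨0, by simp⟩) ∘ Preorder.frestrictLe 0 := rfl
  rw [h1, ← Measure.map_map (by fun_prop) (by fun_prop), Kernel.trajMeasure,
    Measure.map_comp _ _ (by fun_prop), Kernel.traj_map_frestrictLe, Kernel.partialTraj_self,
    Measure.id_comp]
  refine (Measure.map_map (measurable_pi_apply _) (MeasurableEquiv.measurable _)).trans ?_
  exact Measure.map_id

namespace SemiBandit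

variable {d : ℕ} {𝒳 : Finset (Fin d → ℝ)}

namespace Policy

/-- The conditional law of round `n + 1` given the previous rounds. -/
noncomputable def roundKernel (π : Policy 𝒳) (θ : Fin d → ℝ) (n : ℕ) :
    Kernel ((_i : Finset.Iic n) → Round 𝒳) (Round 𝒳) :=
  π.next n ⊗ₖ Kernel.prodMkLeft _ (obsKernel 𝒳 θ)

instance (π : Policy 𝒳) (θ : Fin d → ℝ) (n : ℕ) : IsMarkovKernel (π.roundKernel θ n) := by
  unfold roundKernel; infer_instance

lemma lintegral_roundKernel (π : Policy 𝒳) (θ : Fin d → ℝ) (n : ℕ)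
    (h : (_i : Finset.Iic n) → Round 𝒳) {g : Round 𝒳 → ℝ≥0∞} (hg : Measurable g) :
    ∫⁻ r, g r ∂(π.roundKernel θ n h) =
      ∫⁻ x, ∫⁻ y, g (x, y) ∂(obsLaw θ x.1) ∂(π.next n h) :=
  Kernel.lintegral_compProd _ _ _ hg

lemma lintegral_law_zero (π : Policy 𝒳) (θ : Fin d → ℝ) {g : Round 𝒳 → ℝ≥0∞}
    (hg : Measurable g) :
    ∫⁻ ω, g (ω 0) ∂(π.law θ) = ∫⁻ x, ∫⁻ y, g (x, y) ∂(obsLaw θ x.1) ∂π.first := by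
  have h := Kernel.map_zero_trajMeasure (X := fun _ => Round 𝒳) (π.first ⊗ₘ obsKernel 𝒳 θ)
    (π.roundKernel θ)
  have h2 : ∫⁻ ω, g (ω 0) ∂(π.law θ) = ∫⁻ r, g r ∂((π.law θ).map (fun ω => ω 0)) :=
    (lintegral_map hg (measurable_pi_apply 0)).symm
  rw [h2]
  refine (congrArg (fun μ => ∫⁻ r, g r ∂μ) h).trans ?_
  exact Measure.lintegral_compProd hg

lemma lintegral_law_succ (π : Policy 𝒳) (θ : Fin d → ℝ) (n : ℕ)
    {g : ((_i : Finset.Iic n) → Round 𝒳) × Round 𝒳 → ℝ≥0∞} (hg : Measurable g) :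
    ∫⁻ ω, g (Preorder.frestrictLe n ω, ω (n + 1)) ∂(π.law θ) =
      ∫⁻ ω, ∫⁻ r, g (Preorder.frestrictLe n ω, r)
        ∂(π.roundKernel θ n (Preorder.frestrictLe n ω)) ∂(π.law θ) := by
  have h := Kernel.map_frestrictLe_trajMeasure_compProd_eq_map_trajMeasure
    (X := fun _ => Round 𝒳) (μ₀ := π.first ⊗ₘ obsKernel 𝒳 θ) (κ := π.roundKernel θ) (a := n)
  have hm : Measurable (Preorder.frestrictLe n : (ℕ → Round 𝒳) → _) :=
    Preorder.measurable_frestrictLe n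
  have h2 : ∫⁻ ω, g (Preorder.frestrictLe n ω, ω (n + 1)) ∂(π.law θ) =
      ∫⁻ p, g p ∂((π.law θ).map fun ω => (Preorder.frestrictLe n ω, ω (n + 1))) :=
    (lintegral_map hg (hm.prodMk (measurable_pi_apply _))).symm
  rw [h2]
  refine (congrArg (fun μ => ∫⁻ p, g p ∂μ) h.symm).trans ?_
  rw [Measure.lintegral_compProd hg]
  exact lintegral_map hg.lintegral_kernel_prod_right' hm

/-- Given the current arm, the feedback does not depend on the past. This reduces expectations over
one round to the marginal law of its arm. -/
lemma map_apply_law (π : Policy 𝒳) (θ : Fin d → ℝ) (t : ℕ) :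
    (π.law θ).map (fun ω => ω t) =
      (π.law θ).map (fun ω => (ω t).1) ⊗ₘ obsKernel 𝒳 θ := by
  have hme : Measurable (fun ω : ℕ → Round 𝒳 => ω t) := measurable_pi_apply t
  have hma : Measurable (fun ω : ℕ → Round 𝒳 => (ω t).1) := hme.fst
  refine Measure.ext_of_lintegral _ fun g hg => ?_
  rw [lintegral_map hg hme, Measure.lintegral_compProd hg,
    lintegral_map hg.lintegral_kernel_prod_right' hma]
  -- Averaging the test function over fresh feedback leaves a function of the arm alone; it has the
  -- same integral as `g` against each feedback law, hence against the law of the round.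
  have hG : Measurable fun r : Round 𝒳 => ∫⁻ y, g (r.1, y) ∂(obsKernel 𝒳 θ r.1) :=
    (hg.lintegral_kernel_prod_right' (κ := obsKernel 𝒳 θ)).comp measurable_fst
  have hin : ∀ x : 𝒳, ∫⁻ y', (fun r : Round 𝒳 => ∫⁻ y, g (r.1, y) ∂(obsKernel 𝒳 θ r.1)) (x, y')
      ∂(obsLaw θ x.1) = ∫⁻ y, g (x, y) ∂(obsLaw θ x.1) := fun x => by
    simp only [lintegral_const, measure_univ, mul_one]
    rfl
  cases t with
  | zero =>
    rw [lintegral_law_zero π θ hg, lintegral_law_zero π θ hG]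
    simp_rw [hin]
  | succ n =>
    refine (lintegral_law_succ π θ n (g := fun p => g p.2) (by fun_prop)).trans
      (Eq.trans ?_ (lintegral_law_succ π θ n (hG.comp measurable_snd)).symm)
    refine lintegral_congr fun ω => ?_
    simp only [Function.comp_apply]
    rw [lintegral_roundKernel π θ n _ hg, lintegral_roundKernel π θ n _ hG]
    simp_rw [hin]

/-- The likelihood ratio of one round. -/
noncomputable def roundLR (θ θ' : Fin d → ℝ) (r : Round 𝒳) : ℝ≥0∞ :=
  ENNReal.ofReal (Real.exp (roundLLR θ θ' r))

@[fun_prop]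
lemma measurable_roundLR (θ θ' : Fin d → ℝ) : Measurable (roundLR θ θ' : Round 𝒳 → ℝ≥0∞) := by
  unfold roundLR; fun_prop

lemma lintegral_obsLaw_change (θ θ' : Fin d → ℝ) (x : 𝒳) {g : Round 𝒳 → ℝ≥0∞}
    (hg : Measurable g) :
    ∫⁻ y, g (x, y) ∂(obsLaw θ' x.1) = ∫⁻ y, roundLR θ θ' (x, y) * g (x, y) ∂(obsLaw θ x.1) := by
  rw [obsLaw_eq_withDensity θ θ' x, lintegral_withDensity_eq_lintegral_mul _ (by fun_prop)
    (by fun_prop)]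
  rfl

lemma lintegral_roundKernel_change (π : Policy 𝒳) (θ θ' : Fin d → ℝ) (n : ℕ)
    (h : (_i : Finset.Iic n) → Round 𝒳) {g : Round 𝒳 → ℝ≥0∞} (hg : Measurable g) :
    ∫⁻ r, g r ∂(π.roundKernel θ' n h) =
      ∫⁻ r, roundLR θ θ' r * g r ∂(π.roundKernel θ n h) := by
  rw [lintegral_roundKernel π θ' n h hg,
    lintegral_roundKernel π θ n h (g := fun r => roundLR θ θ' r * g r) (by fun_prop)]
  exact lintegral_congr fun x => lintegral_obsLaw_change θ θ' x hg

/-- Append a round to a history of length `n + 1`. -/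
def snocRound (n : ℕ) (p : ((_i : Finset.Iic n) → Round 𝒳) × Round 𝒳) :
    (_i : Finset.Iic (n + 1)) → Round 𝒳 :=
  fun i => if hi : i.1 ≤ n then p.1 ⟨i.1, Finset.mem_Iic.2 hi⟩ else p.2

lemma measurable_snocRound (n : ℕ) :
    Measurable (snocRound n : _ → (_i : Finset.Iic (n + 1)) → Round 𝒳) := by
  refine measurable_pi_lambda _ fun i => ?_
  unfold snocRound
  split_ifs <;> fun_prop

lemma snocRound_frestrictLe (n : ℕ) (ω : ℕ → Round 𝒳) :
    snocRound n (Preorder.frestrictLe n ω, ω (n + 1)) = Preorder.frestrictLe (n + 1) ω := by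
  ext1 i
  unfold snocRound
  split_ifs with hi
  · rfl
  · have h1 := Finset.mem_Iic.1 i.2
    have h2 : i.1 = n + 1 := by omega
    simp only [Preorder.frestrictLe_apply, h2]

/-- **Change of measure**: the likelihood ratio of the first `n + 1` rounds is the product of the
likelihood ratios of the rounds. -/
theorem lintegral_law_change (π : Policy 𝒳) (θ θ' : Fin d → ℝ) (n : ℕ)
    {f : ((_i : Finset.Iic n) → Round 𝒳) → ℝ≥0∞} (hf : Measurable f) :
    ∫⁻ ω, f (Preorder.frestrictLe n ω) ∂(π.law θ') =
      ∫⁻ ω, (∏ t ∈ Finset.range (n + 1), roundLR θ θ' (ω t)) * f (Preorder.frestrictLe n ω)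
        ∂(π.law θ) := by
  induction n with
  | zero =>
    have e : ∀ ω : ℕ → Round 𝒳, Preorder.frestrictLe 0 ω =
        fun _ : Finset.Iic 0 => ω 0 := fun ω => by
      ext1 i
      have : i.1 = 0 := Nat.le_zero.1 (Finset.mem_Iic.1 i.2)
      simp [this]
    have hg : Measurable fun r : Round 𝒳 => f fun _ => r :=
      hf.comp (measurable_pi_lambda _ fun _ => measurable_id)
    simp only [e, zero_add, Finset.range_one, Finset.prod_singleton]
    rw [lintegral_law_zero π θ' hg,
      lintegral_law_zero π θ (g := fun r => roundLR θ θ' r * f fun _ => r) (by fun_prop)]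
    exact lintegral_congr fun x => lintegral_obsLaw_change θ θ' x hg
  | succ n ih =>
    have hs := measurable_snocRound (𝒳 := 𝒳) n
    have hfs : Measurable fun p => f (snocRound (𝒳 := 𝒳) n p) := hf.comp hs
    -- The likelihood ratio of the first `n + 1` rounds, as a function of the history, so that the
    -- last round can be integrated out conditionally on it.
    let Z : ((_i : Finset.Iic n) → Round 𝒳) → ℝ≥0∞ := fun h =>
      ∏ t ∈ (Finset.range (n + 1)).attach,
        roundLR θ θ' (h ⟨t.1, Finset.mem_Iic.2 (Nat.lt_succ_iff.1 (Finset.mem_range.1 t.2))⟩)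
    have hZ : Measurable Z := by fun_prop
    have hZe : ∀ ω : ℕ → Round 𝒳, Z (Preorder.frestrictLe n ω) =
        ∏ t ∈ Finset.range (n + 1), roundLR θ θ' (ω t) := fun ω =>
      Finset.prod_attach (Finset.range (n + 1)) fun t => roundLR θ θ' (ω t)
    simp_rw [← snocRound_frestrictLe, Finset.prod_range_succ _ (n + 1), ← hZe]
    rw [lintegral_law_succ π θ' n (g := fun p => f (snocRound n p)) hfs,
      lintegral_law_succ π θ n
        (g := fun p => Z p.1 * roundLR θ θ' p.2 * f (snocRound n p)) (by fun_prop),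
      ih (f := fun h => ∫⁻ r, f (snocRound n (h, r)) ∂(π.roundKernel θ' n h))
        hfs.lintegral_kernel_prod_right']
    refine lintegral_congr fun ω => ?_
    have hfr : Measurable fun r => f (snocRound n (Preorder.frestrictLe n ω, r)) :=
      hfs.comp measurable_prodMk_left
    rw [lintegral_roundKernel_change π θ θ' n _ hfr, ← hZe,
      ← lintegral_const_mul _ (by fun_prop)]
    simp only [mul_assoc]

end Policy

end SemiBandit

namespace SemiBandit

namespace Policy

variable {d : ℕ} {𝒳 : Finset (Fin d → ℝ)}

/-! ### Expected numbers of pulls -/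

/-- The expected number of pulls of the arm `x` during the first `T` rounds. -/
noncomputable def armMean (π : Policy 𝒳) (θ : Fin d → ℝ) (T : ℕ) (x : 𝒳) : ℝ :=
  ∑ t ∈ Finset.range T, ((π.law θ).map fun ω => (ω t).1).real {x}

/-- The expected number of observations of the coordinate `i` during the first `T` rounds. -/
noncomputable def coordMean (π : Policy 𝒳) (θ : Fin d → ℝ) (T : ℕ) (i : Fin d) : ℝ :=
  ∑ x : 𝒳 with x.1 i = 1, π.armMean θ T x

@[fun_prop]
lemma measurable_arm (t : ℕ) : Measurable fun ω : ℕ → Round 𝒳 => (ω t).1 :=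
  (measurable_pi_apply t).fst

instance (π : Policy 𝒳) (θ : Fin d → ℝ) (t : ℕ) :
    IsProbabilityMeasure ((π.law θ).map fun ω => (ω t).1) :=
  Measure.isProbabilityMeasure_map (measurable_arm t).aemeasurable

lemma armMean_nonneg (π : Policy 𝒳) (θ : Fin d → ℝ) (T : ℕ) (x : 𝒳) : 0 ≤ π.armMean θ T x :=
  Finset.sum_nonneg fun _ _ => measureReal_nonneg

lemma coordMean_nonneg (π : Policy 𝒳) (θ : Fin d → ℝ) (T : ℕ) (i : Fin d) :
    0 ≤ π.coordMean θ T i :=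
  Finset.sum_nonneg fun _ _ => armMean_nonneg _ _ _ _

lemma armMean_mono (π : Policy 𝒳) (θ : Fin d → ℝ) (x : 𝒳) :
    Monotone fun T => π.armMean θ T x := fun _ _ h =>
  Finset.sum_le_sum_of_subset_of_nonneg (Finset.range_mono h) fun _ _ _ => measureReal_nonneg

lemma coordMean_mono (π : Policy 𝒳) (θ : Fin d → ℝ) (i : Fin d) :
    Monotone fun T => π.coordMean θ T i := fun _ _ h =>
  Finset.sum_le_sum fun x _ => armMean_mono π θ x h

lemma armMean_le_coordMean (π : Policy 𝒳) (θ : Fin d → ℝ) (T : ℕ) {x : 𝒳} {i : Fin d}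
    (h : x.1 i = 1) : π.armMean θ T x ≤ π.coordMean θ T i :=
  Finset.single_le_sum (f := fun x => π.armMean θ T x) (fun _ _ => armMean_nonneg _ _ _ _)
    (by simp [h])

lemma integrable_comp_arm (π : Policy 𝒳) (θ : Fin d → ℝ) (t : ℕ) (F : 𝒳 → ℝ) :
    Integrable (fun ω => F (ω t).1) (π.law θ) := by
  have h : Integrable F ((π.law θ).map fun ω => (ω t).1) := Integrable.of_finite
  exact (integrable_map_measure h.aestronglyMeasurable (measurable_arm t).aemeasurable).1 h

lemma integral_comp_arm (π : Policy 𝒳) (θ : Fin d → ℝ) (t : ℕ) (F : 𝒳 → ℝ) :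
    ∫ ω, F (ω t).1 ∂(π.law θ) =
      ∑ x, ((π.law θ).map fun ω => (ω t).1).real {x} * F x := by
  rw [← integral_map (f := F) (measurable_arm t).aemeasurable
    (measurable_of_countable F).aestronglyMeasurable, integral_fintype Integrable.of_finite]
  simp

lemma integral_sum_arm (π : Policy 𝒳) (θ : Fin d → ℝ) (T : ℕ) (F : 𝒳 → ℝ) :
    ∫ ω, ∑ t ∈ Finset.range T, F (ω t).1 ∂(π.law θ) = ∑ x, π.armMean θ T x * F x := by
  rw [integral_finsetSum _ fun t _ => integrable_comp_arm π θ t F]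
  simp_rw [integral_comp_arm, armMean, Finset.sum_mul]
  exact Finset.sum_comm

lemma sum_armMean (π : Policy 𝒳) (θ : Fin d → ℝ) (T : ℕ) : ∑ x, π.armMean θ T x = T := by
  have := integral_sum_arm π θ T fun _ => 1
  simpa using this.symm

lemma sum_armMean_mul_sum (π : Policy 𝒳) (θ : Fin d → ℝ) (T : ℕ) (c : Fin d → ℝ) :
    ∑ x : 𝒳, π.armMean θ T x * ∑ i, (if x.1 i = 1 then c i else 0) =
      ∑ i, π.coordMean θ T i * c i := by
  simp_rw [Finset.mul_sum, coordMean, Finset.sum_mul, Finset.sum_filter]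
  rw [Finset.sum_comm]
  exact Finset.sum_congr rfl fun i _ => Finset.sum_congr rfl fun x _ => by split_ifs <;> simp

lemma designMatrix_eq_diagonal (π : Policy 𝒳) (h01 : ∀ x ∈ 𝒳, ∀ i, x i = 0 ∨ x i = 1)
    (θ : Fin d → ℝ) (T : ℕ) :
    π.designMatrix θ T = Matrix.diagonal (π.coordMean θ T) := by
  ext i j
  simp only [designMatrix, Matrix.of_apply, Matrix.sum_apply]
  by_cases hij : i = j
  · subst hij
    simp only [Matrix.diagonal_apply_eq, Matrix.diag_apply, Matrix.vecMulVec_apply]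
    rw [integral_sum_arm π θ T fun x => x.1 i * x.1 i, coordMean, Finset.sum_filter]
    refine Finset.sum_congr rfl fun x _ => ?_
    rcases h01 x.1 x.2 i with h | h <;> simp [h]
  · simp [hij]

lemma regret_eq_sum (π : Policy 𝒳) (θ : Fin d → ℝ) (T : ℕ) :
    π.regret θ T = ∑ x : 𝒳, π.armMean θ T x * ((⨆ y : 𝒳, y.1 ⬝ᵥ θ) - x.1 ⬝ᵥ θ) := by
  rw [regret, integral_sum_arm π θ T fun x => x.1 ⬝ᵥ θ, ← sum_armMean π θ T]
  simp only [mul_sub, Finset.sum_sub_distrib, Finset.sum_mul]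

lemma dotProduct_le_iSup (θ : Fin d → ℝ) (x : 𝒳) : x.1 ⬝ᵥ θ ≤ ⨆ y : 𝒳, y.1 ⬝ᵥ θ :=
  le_ciSup (f := fun y : 𝒳 => y.1 ⬝ᵥ θ) (Set.finite_range _).bddAbove x

/-- Every arm has nonnegative regret, so the pulls of `x` alone bound the total from below. The
choice `x = y` shows that the regret is nonnegative. -/
lemma armMean_mul_le_regret (π : Policy 𝒳) (θ : Fin d → ℝ) (T : ℕ) (x y : 𝒳) :
    π.armMean θ T x * (y.1 ⬝ᵥ θ - x.1 ⬝ᵥ θ) ≤ π.regret θ T := by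
  rw [regret_eq_sum]
  refine le_trans (mul_le_mul_of_nonneg_left (sub_le_sub_right (dotProduct_le_iSup θ y) _)
    (armMean_nonneg _ _ _ _)) ?_
  exact Finset.single_le_sum
    (f := fun x : 𝒳 => π.armMean θ T x * ((⨆ y : 𝒳, y.1 ⬝ᵥ θ) - x.1 ⬝ᵥ θ))
    (fun z _ => mul_nonneg (armMean_nonneg _ _ _ _) (sub_nonneg.2 (dotProduct_le_iSup θ z)))
    (Finset.mem_univ x)

/-- Each round spent away from `a` costs at least `m`. -/
lemma mul_sub_armMean_le_regret (π : Policy 𝒳) (θ : Fin d → ℝ) (T : ℕ) (a : 𝒳) {m : ℝ}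
    (hm : ∀ x : 𝒳, x ≠ a → m ≤ a.1 ⬝ᵥ θ - x.1 ⬝ᵥ θ) :
    m * (T - π.armMean θ T a) ≤ π.regret θ T := by
  have h : (T : ℝ) - π.armMean θ T a = ∑ x ∈ Finset.univ.erase a, π.armMean θ T x := by
    rw [← sum_armMean π θ T, ← Finset.add_sum_erase _ _ (Finset.mem_univ a)]
    ring
  rw [h, regret_eq_sum, ← Finset.add_sum_erase _ _ (Finset.mem_univ a), Finset.mul_sum]
  refine le_add_of_nonneg_of_le (mul_nonneg (armMean_nonneg _ _ _ _)
    (sub_nonneg.2 (dotProduct_le_iSup θ a))) (Finset.sum_le_sum fun x hx => ?_)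
  rw [mul_comm]
  refine mul_le_mul_of_nonneg_left ?_ (armMean_nonneg _ _ _ _)
  linarith [hm x (Finset.ne_of_mem_erase hx), dotProduct_le_iSup θ a]

/-- If the expected count stayed zero, almost surely no arm containing `i` would ever be pulled.
Positivity is what makes `G_T` invertible for large `T`. -/
lemma exists_coordMean_pos (π : Policy 𝒳) (θ : Fin d → ℝ)
    (hpull : ∀ᵐ ω ∂(π.law θ), ∀ i, ∃ T, 1 ≤ pullCount T i ω) (i : Fin d) :
    ∃ T, 0 < π.coordMean θ T i := by
  by_contra! hcon
  have hz : ∀ (t : ℕ) (x : 𝒳), x.1 i = 1 → ∀ᵐ ω ∂(π.law θ), (ω t).1 ≠ x := by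
    intro t x hx
    have h0 : π.armMean θ (t + 1) x = 0 :=
      le_antisymm ((armMean_le_coordMean π θ _ hx).trans (hcon _)) (armMean_nonneg _ _ _ _)
    rw [armMean, Finset.sum_eq_zero_iff_of_nonneg fun _ _ => measureReal_nonneg] at h0
    have h1 := h0 t (by simp)
    rw [measureReal_eq_zero_iff, Measure.map_apply (measurable_arm t) (measurableSet_singleton x)]
      at h1
    exact measure_eq_zero_iff_ae_notMem.1 h1
  have hall : ∀ᵐ ω ∂(π.law θ), ∀ (t : ℕ) (x : 𝒳), x.1 i = 1 → (ω t).1 ≠ x := by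
    refine ae_all_iff.2 fun t => ae_all_iff.2 fun x => ?_
    by_cases hx : x.1 i = 1
    · filter_upwards [hz t x hx] with ω h _ using h
    · exact ae_of_all _ fun _ h => absurd h hx
  obtain ⟨ω, h1, h2⟩ := (hall.and hpull).exists
  obtain ⟨T, hT⟩ := h2 i
  obtain ⟨t, ht⟩ := Finset.card_pos.1 hT
  exact h1 t _ (Finset.mem_filter.1 ht).2 rfl

lemma eventually_coordMean_pos (π : Policy 𝒳) (θ : Fin d → ℝ)
    (hpull : ∀ᵐ ω ∂(π.law θ), ∀ i, ∃ T, 1 ≤ pullCount T i ω) :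
    ∀ᶠ T in atTop, ∀ i, 0 < π.coordMean θ T i := by
  refine eventually_all.2 fun i => ?_
  obtain ⟨T, hT⟩ := exists_coordMean_pos π θ hpull i
  filter_upwards [eventually_ge_atTop T] with S hS using hT.trans_le (coordMean_mono π θ i hS)

/-! ### The information inequality -/

/-- The relative entropy between the laws of the first `T` rounds under `θ` and `θ'`. -/
noncomputable def information (π : Policy 𝒳) (θ θ' : Fin d → ℝ) (T : ℕ) : ℝ :=
  ∑ i, π.coordMean θ T i * ((θ' i - θ i) ^ 2 / 2)

lemma integrable_roundLLR (π : Policy 𝒳) (θ θ' : Fin d → ℝ) (t : ℕ) :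
    Integrable (fun ω => roundLLR θ θ' (ω t)) (π.law θ) := by
  have hm : Measurable fun ω : ℕ → Round 𝒳 => ω t := measurable_pi_apply t
  refine Integrable.comp_measurable (f := fun ω : ℕ → Round 𝒳 => ω t) (g := roundLLR θ θ') ?_ hm
  rw [map_apply_law, Measure.integrable_compProd_iff
    (measurable_roundLLR θ θ').aestronglyMeasurable]
  exact ⟨ae_of_all _ fun x => integrable_roundLLR_obsLaw θ θ' x, Integrable.of_finite⟩

lemma integral_roundLLR (π : Policy 𝒳) (θ θ' : Fin d → ℝ) (t : ℕ) :
    ∫ ω, roundLLR θ θ' (ω t) ∂(π.law θ) =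
      ∫ ω, -∑ i, (if (ω t).1.1 i = 1 then (θ' i - θ i) ^ 2 / 2 else 0) ∂(π.law θ) := by
  have hm : Measurable fun ω : ℕ → Round 𝒳 => ω t := measurable_pi_apply t
  have hi : Integrable (roundLLR θ θ') ((π.law θ).map fun ω => ω t) :=
    (integrable_map_measure (measurable_roundLLR θ θ').aestronglyMeasurable hm.aemeasurable).2
      (integrable_roundLLR π θ θ' t)
  rw [← integral_map (f := roundLLR θ θ') hm.aemeasurable
    (measurable_roundLLR θ θ').aestronglyMeasurable]
  rw [map_apply_law] at hi ⊢
  rw [Measure.integral_compProd hi, integral_map (measurable_arm t).aemeasurable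
    (measurable_of_countable _).aestronglyMeasurable]
  exact integral_congr_ae (ae_of_all _ fun ω => integral_roundLLR_obsLaw θ θ' (ω t).1)

/-- The log-likelihood ratio of the first `T` rounds under `θ'` with respect to `θ`. -/
noncomputable def pathLLR (θ θ' : Fin d → ℝ) (T : ℕ) (ω : ℕ → Round 𝒳) : ℝ :=
  ∑ t ∈ Finset.range T, roundLLR θ θ' (ω t)

lemma measurable_pathLLR (θ θ' : Fin d → ℝ) (T : ℕ) :
    Measurable (pathLLR θ θ' T : (ℕ → Round 𝒳) → ℝ) := by
  unfold pathLLR; fun_prop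

lemma integrable_pathLLR (π : Policy 𝒳) (θ θ' : Fin d → ℝ) (T : ℕ) :
    Integrable (pathLLR θ θ' T) (π.law θ) :=
  integrable_finsetSum _ fun t _ => integrable_roundLLR π θ θ' t

lemma integral_pathLLR (π : Policy 𝒳) (θ θ' : Fin d → ℝ) (T : ℕ) :
    ∫ ω, pathLLR θ θ' T ω ∂(π.law θ) = -π.information θ θ' T := by
  unfold pathLLR
  rw [integral_finsetSum _ fun t _ => integrable_roundLLR π θ θ' t]
  simp_rw [integral_roundLLR]
  rw [← integral_finsetSum _ fun t _ => integrable_comp_arm π θ t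
      fun x => -∑ i, (if x.1 i = 1 then (θ' i - θ i) ^ 2 / 2 else 0),
    integral_sum_arm π θ T fun x => -∑ i, (if x.1 i = 1 then (θ' i - θ i) ^ 2 / 2 else 0)]
  simp_rw [mul_neg, Finset.sum_neg_distrib]
  rw [sum_armMean_mul_sum, information]

/-- Real-valued change of measure for statistics in `[0, 1]`; boundedness under `θ'` supplies
integrability under `θ`. A history indexed by `Iic n` has `n + 1` rounds. -/
lemma integral_mul_exp_pathLLR (π : Policy 𝒳) (θ θ' : Fin d → ℝ) (n : ℕ)
    {φ : ((_i : Finset.Iic n) → Round 𝒳) → ℝ} (hφ : Measurable φ) (h0 : ∀ h, 0 ≤ φ h)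
    (h1 : ∀ h, φ h ≤ 1) :
    Integrable (fun ω => Real.exp (pathLLR θ θ' (n + 1) ω) * φ (Preorder.frestrictLe n ω))
      (π.law θ) ∧
    ∫ ω, Real.exp (pathLLR θ θ' (n + 1) ω) * φ (Preorder.frestrictLe n ω) ∂(π.law θ) =
      ∫ ω, φ (Preorder.frestrictLe n ω) ∂(π.law θ') := by
  have hr : Measurable (Preorder.frestrictLe n : (ℕ → Round 𝒳) → _) :=
    Preorder.measurable_frestrictLe n
  have hm : Measurable fun ω : ℕ → Round 𝒳 =>
      Real.exp (pathLLR θ θ' (n + 1) ω) * φ (Preorder.frestrictLe n ω) :=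
    (measurable_pathLLR θ θ' _).exp.mul (hφ.comp hr)
  have hnn : ∀ ω : ℕ → Round 𝒳,
      0 ≤ Real.exp (pathLLR θ θ' (n + 1) ω) * φ (Preorder.frestrictLe n ω) :=
    fun ω => mul_nonneg (Real.exp_pos _).le (h0 _)
  have key : ∫⁻ ω, ENNReal.ofReal
      (Real.exp (pathLLR θ θ' (n + 1) ω) * φ (Preorder.frestrictLe n ω)) ∂(π.law θ) =
      ∫⁻ ω, ENNReal.ofReal (φ (Preorder.frestrictLe n ω)) ∂(π.law θ') := by
    rw [lintegral_law_change π θ θ' n (f := fun h => ENNReal.ofReal (φ h)) (by fun_prop)]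
    refine lintegral_congr fun ω => ?_
    rw [ENNReal.ofReal_mul (Real.exp_pos _).le, pathLLR, Real.exp_sum,
      ENNReal.ofReal_prod_of_nonneg fun _ _ => (Real.exp_pos _).le]
    rfl
  constructor
  · refine ⟨hm.aestronglyMeasurable, ?_⟩
    rw [hasFiniteIntegral_iff_ofReal (ae_of_all _ hnn), key]
    calc _ ≤ ∫⁻ _, 1 ∂(π.law θ') := lintegral_mono fun ω => by simpa using h1 _
      _ < ∞ := by simp
  · rw [integral_eq_lintegral_of_nonneg_ae (ae_of_all _ hnn) hm.aestronglyMeasurable,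
      integral_eq_lintegral_of_nonneg_ae (ae_of_all _ fun ω => h0 _)
        (hφ.comp hr).aestronglyMeasurable, key]

/-- A convex combination, with weights `f` and `1 - f`, of two AM–GM bounds: `2E ≤ lam E² + 1/lam`
and `2E ≤ lam + E²/lam`, where `E = exp (L / 2)`. In the application `f` is the fraction of rounds
playing the optimal arm, so the terms weighted by `lam` are the small ones. -/
lemma exp_half_le {L lam f : ℝ} (hlam : 0 < lam) (h0 : 0 ≤ f) (h1 : f ≤ 1) :
    2 * Real.exp (L / 2) ≤
      lam * (Real.exp L * f) + (1 - f) * lam + f * lam⁻¹ + lam⁻¹ * (Real.exp L * (1 - f)) := by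
  have hL : Real.exp L = Real.exp (L / 2) ^ 2 := by
    rw [sq, ← Real.exp_add]; ring_nf
  have hl : lam * lam⁻¹ = 1 := mul_inv_cancel₀ hlam.ne'
  have hi : 0 < lam⁻¹ := inv_pos.2 hlam
  rw [hL]
  set E := Real.exp (L / 2)
  have a1 : 2 * E ≤ lam * E ^ 2 + lam⁻¹ := by
    have : 0 ≤ lam⁻¹ * (lam * E - 1) ^ 2 := by positivity
    have e : lam⁻¹ * (lam * E - 1) ^ 2 = (lam * lam⁻¹) * lam * E ^ 2 - 2 * (lam * lam⁻¹) * E +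
      lam⁻¹ := by ring
    rw [e, hl] at this; linarith
  have a2 : 2 * E ≤ lam + lam⁻¹ * E ^ 2 := by
    have : 0 ≤ lam⁻¹ * (E - lam) ^ 2 := by positivity
    have e : lam⁻¹ * (E - lam) ^ 2 = lam⁻¹ * E ^ 2 - 2 * (lam * lam⁻¹) * E +
      (lam * lam⁻¹) * lam := by ring
    rw [e, hl] at this; linarith
  nlinarith [mul_le_mul_of_nonneg_left a1 h0, mul_le_mul_of_nonneg_left a2 (sub_nonneg.2 h1)]

/-- A Bretagnolle–Huber type inequality: if the policy plays `a` often under `θ` and rarely under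
`θ'`, the information collected under `θ` to tell `θ` from `θ'` is large. -/
theorem exp_neg_information_le (π : Policy 𝒳) (θ θ' : Fin d → ℝ) {T : ℕ} (hT : T ≠ 0) (a : 𝒳)
    {lam : ℝ} (hlam : 0 < lam) :
    2 * Real.exp (-π.information θ θ' T / 2) ≤
      lam * (π.armMean θ' T a / T + (1 - π.armMean θ T a / T)) + 2 * lam⁻¹ := by
  classical
  obtain ⟨n, rfl⟩ := Nat.exists_eq_succ_of_ne_zero hT
  have hT0 : (0 : ℝ) < ((n + 1 : ℕ) : ℝ) := by positivity
  set N : ℝ := ((n + 1 : ℕ) : ℝ) with hN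
  let F : 𝒳 → ℝ := fun x => if x = a then 1 else 0
  -- The fraction of rounds playing `a` serves as a randomized test; its means are exactly
  -- normalized pull counts, so no Markov inequality is needed.
  let φ : ((_i : Finset.Iic n) → Round 𝒳) → ℝ := fun h =>
    (∑ t ∈ (Finset.range (n + 1)).attach,
      F (h ⟨t.1, Finset.mem_Iic.2 (Nat.lt_succ_iff.1 (Finset.mem_range.1 t.2))⟩).1) / N
  have hF : Measurable F := measurable_of_countable F
  have hφ : Measurable φ := by fun_prop
  have hF0 : ∀ x, 0 ≤ F x := fun x => by simp only [F]; split_ifs <;> norm_num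
  have hF1 : ∀ x, F x ≤ 1 := fun x => by simp only [F]; split_ifs <;> norm_num
  have h0 : ∀ h, 0 ≤ φ h := fun h => div_nonneg (Finset.sum_nonneg fun _ _ => hF0 _) hT0.le
  have h1 : ∀ h, φ h ≤ 1 := fun h => by
    rw [div_le_one hT0]
    refine (Finset.sum_le_sum fun _ _ => hF1 _).trans ?_
    simp [hN]
  have hφe : ∀ ω : ℕ → Round 𝒳, φ (Preorder.frestrictLe n ω) =
      (∑ t ∈ Finset.range (n + 1), F (ω t).1) / N := fun ω =>
    congrArg (· / N) (Finset.sum_attach (Finset.range (n + 1)) fun t => F (ω t).1)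
  have hφi : ∀ η : Fin d → ℝ, Integrable (fun ω => φ (Preorder.frestrictLe n ω)) (π.law η) := by
    intro η
    simp_rw [hφe]
    exact (integrable_finsetSum _ fun t _ => integrable_comp_arm π η t F).div_const _
  have hφm : ∀ η : Fin d → ℝ, ∫ ω, φ (Preorder.frestrictLe n ω) ∂(π.law η) =
      π.armMean η (n + 1) a / N := by
    intro η
    simp_rw [hφe]
    rw [integral_div, integral_sum_arm]
    simp [F]
  obtain ⟨i1, e1⟩ := integral_mul_exp_pathLLR π θ θ' n hφ h0 h1
  obtain ⟨i2, e2⟩ := integral_mul_exp_pathLLR π θ θ' n (φ := fun h => 1 - φ h)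
    (measurable_const.sub hφ) (fun h => sub_nonneg.2 (h1 h)) fun h => by linarith [h0 h]
  have hi1 : Integrable (fun ω => 1 - φ (Preorder.frestrictLe n ω)) (π.law θ) :=
    (integrable_const 1).sub (hφi θ)
  rw [hφm] at e1
  rw [integral_sub (integrable_const 1) (hφi θ'), hφm, integral_const, probReal_univ, one_smul]
    at e2
  set K := π.information θ θ' (n + 1)
  set c := Real.exp (-K / 2)
  have hc : 0 < c := Real.exp_pos _
  -- Jensen's inequality by hand: `exp (L / 2)` lies above its tangent at `L = -K`. As `L` has mean
  -- `-K` under `θ`, the tangent integrates to `c`.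
  have hlow : ∀ ω : ℕ → Round 𝒳, 2 * (c * (1 + K / 2) + c / 2 * pathLLR θ θ' (n + 1) ω) ≤
      lam * (Real.exp (pathLLR θ θ' (n + 1) ω) * φ (Preorder.frestrictLe n ω)) +
      (1 - φ (Preorder.frestrictLe n ω)) * lam + φ (Preorder.frestrictLe n ω) * lam⁻¹ +
      lam⁻¹ * (Real.exp (pathLLR θ θ' (n + 1) ω) * (1 - φ (Preorder.frestrictLe n ω))) := by
    intro ω
    refine le_trans ?_ (exp_half_le hlam (h0 _) (h1 _))
    have := Real.add_one_le_exp ((pathLLR θ θ' (n + 1) ω + K) / 2)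
    have e : Real.exp (pathLLR θ θ' (n + 1) ω / 2) =
        c * Real.exp ((pathLLR θ θ' (n + 1) ω + K) / 2) := by
      rw [← Real.exp_add]; ring_nf
    rw [e]
    nlinarith [mul_le_mul_of_nonneg_left this hc.le]
  have hL := integrable_pathLLR π θ θ' (n + 1)
  have hI := integral_mono
    (((integrable_const (c * (1 + K / 2))).fun_add (hL.const_mul (c / 2))).const_mul 2)
    ((((i1.const_mul lam).fun_add (hi1.mul_const lam)).fun_add ((hφi θ).mul_const lam⁻¹)).fun_add
      (i2.const_mul lam⁻¹)) hlow
  have eL : ∫ ω, 2 * (c * (1 + K / 2) + c / 2 * pathLLR θ θ' (n + 1) ω) ∂(π.law θ) = 2 * c := by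
    rw [integral_const_mul, integral_add (integrable_const _) (hL.const_mul _),
      integral_const, probReal_univ, one_smul, integral_const_mul, integral_pathLLR]
    ring
  have eR : ∫ ω, (lam * (Real.exp (pathLLR θ θ' (n + 1) ω) * φ (Preorder.frestrictLe n ω)) +
      (1 - φ (Preorder.frestrictLe n ω)) * lam + φ (Preorder.frestrictLe n ω) * lam⁻¹ +
      lam⁻¹ * (Real.exp (pathLLR θ θ' (n + 1) ω) * (1 - φ (Preorder.frestrictLe n ω))))
      ∂(π.law θ) = lam * (π.armMean θ' (n + 1) a / N) + (1 - π.armMean θ (n + 1) a / N) * lam +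
        π.armMean θ (n + 1) a / N * lam⁻¹ + lam⁻¹ * (1 - π.armMean θ' (n + 1) a / N) := by
    rw [integral_add (((i1.const_mul lam).fun_add (hi1.mul_const lam)).fun_add
        ((hφi θ).mul_const lam⁻¹)) (i2.const_mul lam⁻¹),
      integral_add ((i1.const_mul lam).fun_add (hi1.mul_const lam)) ((hφi θ).mul_const lam⁻¹),
      integral_add (i1.const_mul lam) (hi1.mul_const lam), integral_const_mul, integral_const_mul,
      integral_mul_const, integral_mul_const, e1, e2, hφm,
      integral_sub (integrable_const 1) (hφi θ), hφm, integral_const, probReal_univ, one_smul]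
  have hI2 := eL.symm.le.trans (hI.trans eR.le)
  have ha : π.armMean θ (n + 1) a / N ≤ 1 := by
    have := integral_mono (hφi θ) (integrable_const 1) fun ω => h1 _
    rwa [hφm, integral_const, probReal_univ, one_smul] at this
  have ha' : 0 ≤ π.armMean θ' (n + 1) a / N := div_nonneg (armMean_nonneg _ _ _ _) hT0.le
  have hi : 0 < lam⁻¹ := inv_pos.2 hlam
  show 2 * c ≤ _
  nlinarith [mul_le_mul_of_nonneg_left ha hi.le, mul_nonneg hi.le ha']

end Policy

end SemiBandit

namespace SemiBandit

namespace Policy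

variable {d : ℕ} {𝒳 : Finset (Fin d → ℝ)}

/-! ### Consequences of consistency -/

lemma Consistent.eventually_regret_le {π : Policy 𝒳} (hπ : π.Consistent) (θ : Fin d → ℝ)
    {p : ℝ} (hp : 0 < p) {c : ℝ} (hc : 0 < c) :
    ∀ᶠ T : ℕ in atTop, π.regret θ T ≤ c * (T : ℝ) ^ p := by
  filter_upwards [(hπ θ p hp).bound hc] with T hT
  rw [Real.norm_of_nonneg (Real.rpow_nonneg (Nat.cast_nonneg T) p)] at hT
  exact (le_abs_self _).trans hT

/-- Under a consistent policy, the information that tells `θ` from an instance where the optimal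
arm of `θ` is suboptimal grows at least like `log T`. -/
theorem Consistent.eventually_le_information {π : Policy 𝒳} (hπ : π.Consistent)
    (θ θ' : Fin d → ℝ) (a y : 𝒳) {m δ p : ℝ} (hm : 0 < m)
    (hgap : ∀ x : 𝒳, x ≠ a → m ≤ a.1 ⬝ᵥ θ - x.1 ⬝ᵥ θ)
    (hδ : 0 < δ) (hy : δ ≤ y.1 ⬝ᵥ θ' - a.1 ⬝ᵥ θ') (hp : 0 < p) :
    ∀ᶠ T : ℕ in atTop, (1 - p) * Real.log T - 2 * Real.log 2 ≤ π.information θ θ' T := by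
  filter_upwards [hπ.eventually_regret_le θ hp (half_pos hm),
    hπ.eventually_regret_le θ' hp (half_pos hδ), eventually_ge_atTop 1] with T h1 h2 hT
  have hT0 : (0 : ℝ) < T := by exact_mod_cast hT
  have h3 : T - π.armMean θ T a ≤ (T : ℝ) ^ p / 2 := by
    have := (mul_sub_armMean_le_regret π θ T a hgap).trans h1
    rw [show m / 2 * (T : ℝ) ^ p = m * ((T : ℝ) ^ p / 2) by ring] at this
    exact le_of_mul_le_mul_left this hm
  have h4 : π.armMean θ' T a ≤ (T : ℝ) ^ p / 2 := by
    have := ((mul_le_mul_of_nonneg_left hy (armMean_nonneg π θ' T a)).trans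
      (armMean_mul_le_regret π θ' T a y)).trans h2
    rw [show δ / 2 * (T : ℝ) ^ p = ((T : ℝ) ^ p / 2) * δ by ring] at this
    exact le_of_mul_le_mul_right this hδ
  set l := Real.log T with hl
  have hTl : (T : ℝ) = Real.exp l := (Real.exp_log hT0).symm
  have hTp : (T : ℝ) ^ p = Real.exp (l * p) := Real.rpow_def_of_pos hT0 p
  -- The choice `lam = T^((1 - p) / 2)` balances the two terms, because the testing error is at most
  -- `T^(p - 1) = lam⁻²`.
  set lam := Real.exp (l * (1 - p) / 2) with hlam
  have hlam0 : 0 < lam := Real.exp_pos _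
  have hq : π.armMean θ' T a / T + (1 - π.armMean θ T a / T) ≤ lam⁻¹ * lam⁻¹ := by
    have e1 : lam⁻¹ * lam⁻¹ = (T : ℝ) ^ p / T := by
      rw [hTp, hTl, ← Real.exp_sub, hlam, ← Real.exp_neg, ← Real.exp_add]
      ring_nf
    have e2 : π.armMean θ' T a / T + (1 - π.armMean θ T a / T) =
        (π.armMean θ' T a + (T - π.armMean θ T a)) / T := by
      field_simp
    rw [e1, e2]
    exact div_le_div_of_nonneg_right (by linarith) hT0.le
  have hBH := exp_neg_information_le π θ θ' (by omega : T ≠ 0) a hlam0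
  have hq2 : lam * (π.armMean θ' T a / T + (1 - π.armMean θ T a / T)) ≤ lam⁻¹ := by
    refine (mul_le_mul_of_nonneg_left hq hlam0.le).trans (le_of_eq ?_)
    rw [← mul_assoc, mul_inv_cancel₀ hlam0.ne', one_mul]
  -- The bound obtained is `3/2 · lam⁻¹`, rounded up to `2 · lam⁻¹`.
  have h5 : Real.exp (-π.information θ θ' T / 2) ≤ Real.exp (Real.log 2 - l * (1 - p) / 2) := by
    rw [sub_eq_add_neg, Real.exp_add, Real.exp_log two_pos, Real.exp_neg, ← hlam]
    have : 0 < lam⁻¹ := inv_pos.2 hlam0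
    linarith
  have h6 := Real.exp_le_exp.1 h5
  linarith

lemma exists_gap_pos (θ : Fin d → ℝ) (a : 𝒳)
    (hopt : ∀ x : 𝒳, x ≠ a → x.1 ⬝ᵥ θ < a.1 ⬝ᵥ θ) :
    ∃ m : ℝ, 0 < m ∧ ∀ x : 𝒳, x ≠ a → m ≤ a.1 ⬝ᵥ θ - x.1 ⬝ᵥ θ := by
  classical
  have h : ∀ᶠ m : ℝ in 𝓝[>] 0, ∀ x : 𝒳, x ≠ a → m ≤ a.1 ⬝ᵥ θ - x.1 ⬝ᵥ θ := by
    refine eventually_all.2 fun x => ?_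
    by_cases hx : x = a
    · exact Eventually.of_forall fun _ h => absurd hx h
    · filter_upwards [Ioc_mem_nhdsGT (sub_pos.2 (hopt x hx))] with m hm _ using hm.2
  obtain ⟨m, hm, hm0⟩ := (h.and self_mem_nhdsWithin).exists
  exact ⟨m, hm0, hm⟩

/-- The coordinates of the optimal arm are observed linearly often. -/
lemma Consistent.tendsto_log_div_coordMean {π : Policy 𝒳} (hπ : π.Consistent) (θ : Fin d → ℝ)
    (a : 𝒳) (hopt : ∀ x : 𝒳, x ≠ a → x.1 ⬝ᵥ θ < a.1 ⬝ᵥ θ) {i : Fin d} (hi : a.1 i = 1) :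
    Tendsto (fun T : ℕ => Real.log T * (π.coordMean θ T i)⁻¹) atTop (𝓝 0) := by
  obtain ⟨m, hm, hgap⟩ := exists_gap_pos θ a hopt
  have hlim : Tendsto (fun T : ℕ => 2 * (Real.log T / T)) atTop (𝓝 0) := by
    have := ((Real.isLittleO_log_id_atTop.tendsto_div_nhds_zero).comp
      tendsto_natCast_atTop_atTop).const_mul (2 : ℝ)
    simpa using this
  refine squeeze_zero' ?_ ?_ hlim
  · filter_upwards [eventually_ge_atTop 1] with T hT
    exact mul_nonneg (Real.log_nonneg (by exact_mod_cast hT))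
      (inv_nonneg.2 (coordMean_nonneg _ _ _ _))
  · filter_upwards [hπ.eventually_regret_le θ one_pos (half_pos hm), eventually_ge_atTop 1]
      with T h1 hT
    have hT0 : (0 : ℝ) < T := by exact_mod_cast hT
    have h2 := (mul_sub_armMean_le_regret π θ T a hgap).trans h1
    rw [Real.rpow_one, show m / 2 * (T : ℝ) = m * (T / 2) by ring] at h2
    have h3 := le_of_mul_le_mul_left h2 hm
    have h4 : (T : ℝ) / 2 ≤ π.coordMean θ T i := by
      linarith [armMean_le_coordMean π θ T (x := a) hi]
    calc Real.log T * (π.coordMean θ T i)⁻¹ ≤ Real.log T * ((T : ℝ) / 2)⁻¹ :=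
          mul_le_mul_of_nonneg_left (inv_anti₀ (by positivity) h4)
            (Real.log_nonneg (by exact_mod_cast hT))
      _ = 2 * (Real.log T / T) := by field_simp

/-- The asymptotic lower bound on the numbers of observations of the coordinates that distinguish
a suboptimal arm from the optimal one. -/
theorem Consistent.eventually_log_mul_sum_le {π : Policy 𝒳} (hπ : π.Consistent)
    (h01 : ∀ x ∈ 𝒳, ∀ i, x i = 0 ∨ x i = 1) (θ : Fin d → ℝ) (a x : 𝒳)
    (hopt : ∀ x : 𝒳, x ≠ a → x.1 ⬝ᵥ θ < a.1 ⬝ᵥ θ)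
    (hpos : ∀ᶠ T in atTop, ∀ i, 0 < π.coordMean θ T i) (hxa : x ≠ a) {r : ℝ}
    (hr : (a.1 ⬝ᵥ θ - x.1 ⬝ᵥ θ) ^ 2 / 2 < r) :
    ∀ᶠ T : ℕ in atTop,
      Real.log T * ∑ i with x.1 i = 1 ∧ a.1 i ≠ 1, (π.coordMean θ T i)⁻¹ ≤ r := by
  classical
  -- The optimal perturbation depends on `T`, whereas consistency speaks of one fixed `θ'`. If the
  -- bound fails infinitely often, an ultrafilter on the bad times gives the normalized weights a
  -- limit `w`, and `θ'` is built from that limit.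
  by_contra hcon
  set Δ := a.1 ⬝ᵥ θ - x.1 ⬝ᵥ θ with hΔ
  have hΔ0 : 0 < Δ := sub_pos.2 (hopt x hxa)
  have hr0 : 0 < r := lt_of_le_of_lt (by positivity) hr
  set I : Finset (Fin d) := Finset.univ.filter fun i => x.1 i = 1 ∧ a.1 i ≠ 1 with hI
  set S : ℕ → ℝ := fun T => ∑ i ∈ I, (π.coordMean θ T i)⁻¹ with hS
  have hfreq : ∃ᶠ T : ℕ in atTop, r < Real.log T * S T := by
    simpa only [not_eventually, not_le] using hcon
  -- An ultrafilter along which the bound fails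
  have hne : NeBot (atTop ⊓ 𝓟 {T : ℕ | r < Real.log T * S T}) := frequently_mem_iff_neBot.1 hfreq
  set u : Ultrafilter ℕ := Ultrafilter.of (atTop ⊓ 𝓟 {T : ℕ | r < Real.log T * S T})
  have hu : (u : Filter ℕ) ≤ atTop := (Ultrafilter.of_le _).trans inf_le_left
  have hur : ∀ᶠ T : ℕ in (u : Filter ℕ), r < Real.log T * S T :=
    ((Ultrafilter.of_le _).trans inf_le_right) (mem_principal_self _)
  have hupos := hu hpos
  have hS0 : ∀ T, 0 ≤ S T := fun T => Finset.sum_nonneg fun i _ =>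
    inv_nonneg.2 (coordMean_nonneg _ _ _ _)
  have huS : ∀ᶠ T in (u : Filter ℕ), 0 < S T := by
    filter_upwards [hur] with T hT
    refine lt_of_le_of_ne (hS0 T) fun h => ?_
    rw [← h, mul_zero] at hT
    exact absurd hT (not_lt.2 hr0.le)
  -- The limiting direction of perturbation
  set W : ℕ → Fin d → ℝ := fun T i => if i ∈ I then (π.coordMean θ T i)⁻¹ / S T else 0 with hW
  have hWmem : ∀ T, W T ∈ Set.Icc (0 : Fin d → ℝ) 1 := by
    intro T
    refine ⟨fun i => ?_, fun i => ?_⟩ <;> simp only [hW, Pi.zero_apply, Pi.one_apply] <;> split_ifs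
    · exact div_nonneg (inv_nonneg.2 (coordMean_nonneg _ _ _ _)) (hS0 T)
    · exact le_rfl
    · exact div_le_one_of_le₀ (Finset.single_le_sum (f := fun i => (π.coordMean θ T i)⁻¹)
        (fun i _ => inv_nonneg.2 (coordMean_nonneg _ _ _ _)) ‹_›) (hS0 T)
    · exact zero_le_one
  obtain ⟨w, -, hw⟩ := (isCompact_Icc (a := (0 : Fin d → ℝ)) (b := 1)).ultrafilter_le_nhds
    (u.map W) (le_principal_iff.2 (Ultrafilter.mem_map.2 (univ_mem' hWmem)))
  have hw : Tendsto W u (𝓝 w) := hw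
  have hwi : ∀ i, Tendsto (fun T => W T i) u (𝓝 (w i)) := tendsto_pi_nhds.1 hw
  have hw0 : ∀ i, i ∉ I → w i = 0 := fun i hi =>
    tendsto_nhds_unique (hwi i) (by simp only [hW, hi, if_false]; exact tendsto_const_nhds)
  have hwsum : ∑ i, w i = 1 := by
    refine tendsto_nhds_unique (tendsto_finsetSum _ fun i _ => hwi i)
      (tendsto_const_nhds.congr' ?_)
    filter_upwards [huS] with T hT
    simp only [hW]
    rw [Finset.sum_ite_mem, Finset.univ_inter, ← Finset.sum_div, div_self hT.ne']
  -- One `δ` serves both as the margin by which `x` wins under `θ'` and as the exponent `p` in the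
  -- consistency bound.
  obtain ⟨δ, hδ, hδ0⟩ : ∃ δ : ℝ, (Δ + δ) ^ 2 / 2 < r * (1 - δ) ∧ 0 < δ := by
    have hc : ContinuousAt (fun δ : ℝ => r * (1 - δ) - (Δ + δ) ^ 2 / 2) 0 := by fun_prop
    have hc0 : ∀ᶠ δ : ℝ in 𝓝 0, 0 < r * (1 - δ) - (Δ + δ) ^ 2 / 2 :=
      hc.eventually (lt_mem_nhds (by simpa using hr))
    obtain ⟨δ, h1, h2⟩ := ((hc0.filter_mono (nhdsWithin_le_nhds (s := Set.Ioi 0))).and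
      self_mem_nhdsWithin).exists
    exact ⟨δ, by linarith, h2⟩
  set θ' : Fin d → ℝ := θ + (Δ + δ) • w with hθ'
  have hxw : x.1 ⬝ᵥ w = 1 := by
    rw [← hwsum]
    refine Finset.sum_congr rfl fun i _ => ?_
    by_cases hi : i ∈ I
    · rw [((Finset.mem_filter.1 hi).2).1, one_mul]
    · rw [hw0 i hi, mul_zero]
  have haw : a.1 ⬝ᵥ w = 0 := by
    refine Finset.sum_eq_zero fun i _ => ?_
    by_cases hi : i ∈ I
    · rw [(h01 a.1 a.2 i).resolve_right ((Finset.mem_filter.1 hi).2).2, zero_mul]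
    · rw [hw0 i hi, mul_zero]
  have hy : δ ≤ x.1 ⬝ᵥ θ' - a.1 ⬝ᵥ θ' := by
    simp only [hθ', dotProduct_add, dotProduct_smul, hxw, haw, smul_eq_mul]
    linarith
  obtain ⟨m, hm, hgap⟩ := exists_gap_pos θ a hopt
  have hinf := hu (hπ.eventually_le_information θ θ' a x hm hgap hδ0 hy hδ0)
  have hlim : Tendsto (fun T => S T * π.information θ θ' T) u (𝓝 ((Δ + δ) ^ 2 / 2)) := by
    have h1 : ∀ T, S T * π.information θ θ' T =
        (Δ + δ) ^ 2 / 2 * ∑ i, S T * π.coordMean θ T i * w i ^ 2 := by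
      intro T
      simp only [information, hθ', Pi.add_apply, Pi.smul_apply, smul_eq_mul, add_sub_cancel_left,
        Finset.mul_sum]
      exact Finset.sum_congr rfl fun i _ => by ring
    -- On `I` one has `S T * N_i(T) = 1 / W T i`, which tends to `1 / w i` if `w i ≠ 0`. Where `w i
    -- = 0` this factor may blow up, but `θ'` does not move that coordinate and the term vanishes
    -- identically.
    have h2 : ∀ i, Tendsto (fun T => S T * π.coordMean θ T i * w i ^ 2) u (𝓝 (w i)) := by
      intro i
      by_cases hwz : w i = 0
      · simp [hwz]
      · have hi : i ∈ I := by_contra fun hi => hwz (hw0 i hi)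
        have h3 := ((hwi i).inv₀ hwz).mul_const (w i ^ 2)
        rw [show (w i)⁻¹ * w i ^ 2 = w i by field_simp] at h3
        refine h3.congr fun T => ?_
        simp only [hW, hi, if_true, inv_div, div_inv_eq_mul]
    simp_rw [h1]
    have := (tendsto_finsetSum Finset.univ fun i _ => h2 i).const_mul ((Δ + δ) ^ 2 / 2)
    rwa [hwsum, mul_one] at this
  have hlog : Tendsto (fun T : ℕ => Real.log T) u atTop :=
    (Real.tendsto_log_atTop.comp tendsto_natCast_atTop_atTop).mono_left hu
  have hbr : Tendsto (fun T : ℕ => 1 - δ - 2 * Real.log 2 / Real.log T) u (𝓝 (1 - δ)) := by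
    simpa using (hlog.const_div_atTop (2 * Real.log 2)).const_sub (1 - δ)
  have hδ1 : 0 < 1 - δ := by
    by_contra h
    nlinarith [sq_nonneg (Δ + δ), mul_nonneg hr0.le (sub_nonneg.2 (not_lt.1 h))]
  refine absurd (le_of_tendsto_of_tendsto (hbr.const_mul r) hlim ?_) (not_le.2 hδ)
  filter_upwards [hinf, hur, huS, hlog.eventually_gt_atTop 0, hbr.eventually (lt_mem_nhds hδ1)]
    with T g1 g2 g3 g4 g5
  calc r * (1 - δ - 2 * Real.log 2 / Real.log T)
      ≤ Real.log T * S T * (1 - δ - 2 * Real.log 2 / Real.log T) :=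
        mul_le_mul_of_nonneg_right g2.le g5.le
    _ = S T * ((1 - δ) * Real.log T - 2 * Real.log 2) := by field_simp
    _ ≤ S T * π.information θ θ' T := mul_le_mul_of_nonneg_left g1 g3.le

/-- All coordinates of an arm or of the optimal arm contribute at most `Δ² / 2` in the limit. -/
theorem Consistent.eventually_log_mul_sum_union_le {π : Policy 𝒳} (hπ : π.Consistent)
    (h01 : ∀ x ∈ 𝒳, ∀ i, x i = 0 ∨ x i = 1) (θ : Fin d → ℝ) (a x : 𝒳)
    (hopt : ∀ x : 𝒳, x ≠ a → x.1 ⬝ᵥ θ < a.1 ⬝ᵥ θ)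
    (hpos : ∀ᶠ T in atTop, ∀ i, 0 < π.coordMean θ T i) {r : ℝ}
    (hr : (a.1 ⬝ᵥ θ - x.1 ⬝ᵥ θ) ^ 2 / 2 < r) :
    ∀ᶠ T : ℕ in atTop,
      Real.log T * ∑ i with x.1 i = 1 ∨ a.1 i = 1, (π.coordMean θ T i)⁻¹ ≤ r := by
  classical
  obtain ⟨s, hs1, hs2⟩ := exists_between hr
  have h1 : ∀ᶠ T : ℕ in atTop,
      Real.log T * ∑ i with x.1 i = 1 ∧ a.1 i ≠ 1, (π.coordMean θ T i)⁻¹ ≤ s := by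
    by_cases hxa : x = a
    · have hs0 : 0 ≤ s := le_trans (by positivity) hs1.le
      subst hxa
      exact Eventually.of_forall fun T => by simpa using hs0
    · exact hπ.eventually_log_mul_sum_le h01 θ a x hopt hpos hxa hs1
  have h2 : Tendsto (fun T : ℕ => ∑ i with a.1 i = 1, Real.log T * (π.coordMean θ T i)⁻¹) atTop
      (𝓝 (∑ i with a.1 i = 1, 0)) :=
    tendsto_finsetSum _ fun i hi =>
      hπ.tendsto_log_div_coordMean θ a hopt (Finset.mem_filter.1 hi).2
  rw [Finset.sum_const_zero] at h2
  filter_upwards [h1, h2.eventually (gt_mem_nhds (sub_pos.2 hs2))] with T g1 g2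
  rw [← Finset.mul_sum] at g2
  have e : (Finset.univ.filter fun i => x.1 i = 1 ∨ a.1 i = 1) =
      (Finset.univ.filter fun i => x.1 i = 1 ∧ a.1 i ≠ 1) ∪
        Finset.univ.filter fun i => a.1 i = 1 := by
    ext i
    simp only [Finset.mem_filter, Finset.mem_univ, true_and, Finset.mem_union]
    tauto
  rw [e, Finset.sum_union, mul_add]
  · linarith
  · exact Finset.disjoint_filter.2 fun i _ h => h.2

/-! ### From observation counts to matrix norms and feasible allocations -/

lemma sqNorm_inv_designMatrix (π : Policy 𝒳) (h01 : ∀ x ∈ 𝒳, ∀ i, x i = 0 ∨ x i = 1)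
    (θ : Fin d → ℝ) {T : ℕ} (hpos : ∀ i, 0 < π.coordMean θ T i) (v : Fin d → ℝ) :
    sqNorm (π.designMatrix θ T)⁻¹ v = ∑ i, v i ^ 2 * (π.coordMean θ T i)⁻¹ := by
  have hinv : (Matrix.diagonal (π.coordMean θ T))⁻¹ =
      Matrix.diagonal fun i => (π.coordMean θ T i)⁻¹ := by
    refine Matrix.inv_eq_right_inv ?_
    rw [Matrix.diagonal_mul_diagonal, ← Matrix.diagonal_one]
    congr 1
    ext i
    exact mul_inv_cancel₀ (hpos i).ne'
  rw [designMatrix_eq_diagonal π h01, hinv, sqNorm]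
  simp only [Matrix.mulVec_diagonal, dotProduct]
  exact Finset.sum_congr rfl fun i _ => by ring

/-- Both `x` and `x - x_*` have entries in `{-1, 0, 1}` supported on `x ∪ x_*`, so one bound covers
the two norms. -/
lemma sqNorm_inv_designMatrix_le (π : Policy 𝒳) (h01 : ∀ x ∈ 𝒳, ∀ i, x i = 0 ∨ x i = 1)
    (θ : Fin d → ℝ) {T : ℕ} (hpos : ∀ i, 0 < π.coordMean θ T i) {v : Fin d → ℝ} {a x : 𝒳}
    (hv : ∀ i, v i ^ 2 ≤ if x.1 i = 1 ∨ a.1 i = 1 then 1 else 0) :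
    sqNorm (π.designMatrix θ T)⁻¹ v ≤
      ∑ i with x.1 i = 1 ∨ a.1 i = 1, (π.coordMean θ T i)⁻¹ := by
  rw [sqNorm_inv_designMatrix π h01 θ hpos, Finset.sum_filter]
  refine Finset.sum_le_sum fun i _ => ?_
  refine (mul_le_mul_of_nonneg_right (hv i) (inv_nonneg.2 (hpos i).le)).trans (le_of_eq ?_)
  split_ifs <;> simp

end Policy

lemma gap_eq {d : ℕ} (θ a x : Fin d → ℝ) : gap θ a x = a ⬝ᵥ θ - x ⬝ᵥ θ := by
  rw [gap, dotProduct_sub, dotProduct_comm θ a, dotProduct_comm θ x]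

lemma EReal_limsup_le_of_forall_gt {f : ℕ → ℝ} {c : ℝ}
    (h : ∀ r, c < r → ∀ᶠ T in atTop, f T ≤ r) :
    limsup (fun T => (f T : EReal)) atTop ≤ (c : EReal) := by
  refine EReal.le_of_forall_lt_iff_le.1 fun r hr => ?_
  refine limsup_le_of_le (by isBoundedDefault) ?_
  filter_upwards [h r (EReal.coe_lt_coe_iff.1 hr)] with T hT using EReal.coe_le_coe_iff.2 hT

namespace Policy

variable {d : ℕ} {𝒳 : Finset (Fin d → ℝ)}

/-- The rescaled expected numbers of pulls form a feasible allocation. -/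
lemma lowerBoundConst_le (π : Policy 𝒳) (θ : Fin d → ℝ) (a : 𝒳)
    (hopt : ∀ x : 𝒳, x ≠ a → x.1 ⬝ᵥ θ < a.1 ⬝ᵥ θ) {T : ℕ} (hT : 0 < Real.log T)
    (hpos : ∀ i, 0 < π.coordMean θ T i) {s : ℝ} (hs : 0 < s)
    (hfeas : ∀ x : 𝒳, x ≠ a →
      Real.log T * ∑ i with x.1 i = 1 ∨ a.1 i = 1, (π.coordMean θ T i)⁻¹ ≤
        s * ((a.1 ⬝ᵥ θ - x.1 ⬝ᵥ θ) ^ 2 / 2)) :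
    lowerBoundConst 𝒳 θ a.1 ≤ ((s * (π.regret θ T / Real.log T) : ℝ) : EReal) := by
  have hnn : ∀ x, 0 ≤ s / Real.log T * π.armMean θ T x := fun x =>
    mul_nonneg (div_pos hs hT).le (armMean_nonneg _ _ _ _)
  let τ : 𝒳 → ℝ≥0 := fun x => ⟨s / Real.log T * π.armMean θ T x, hnn x⟩
  have hτ : τ ∈ feasible 𝒳 θ a.1 := by
    intro x hx hxa
    have h1 : ∀ i, (∑ x' : 𝒳 with x'.1 i = 1, (τ x' : ℝ≥0∞))⁻¹ =
        ENNReal.ofReal (Real.log T / s * (π.coordMean θ T i)⁻¹) := by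
      intro i
      have h2 : ∀ x', (τ x' : ℝ≥0∞) = ENNReal.ofReal (s / Real.log T * π.armMean θ T x') :=
        fun x' => (ENNReal.ofReal_eq_coe_nnreal (hnn x')).symm
      simp_rw [h2]
      rw [← ENNReal.ofReal_sum_of_nonneg fun x' _ => hnn x', ← Finset.mul_sum, ← coordMean,
        ← ENNReal.ofReal_inv_of_pos (mul_pos (div_pos hs hT) (hpos i)), mul_inv, inv_div]
    simp_rw [h1]
    have hnn' : ∀ i, 0 ≤ Real.log T / s * (π.coordMean θ T i)⁻¹ := fun i =>
      mul_nonneg (div_pos hT hs).le (inv_nonneg.2 (hpos i).le)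
    rw [← ENNReal.ofReal_sum_of_nonneg fun i _ => hnn' i]
    refine ENNReal.ofReal_le_ofReal ?_
    rw [gap_eq, ← Finset.mul_sum]
    have h3 := hfeas ⟨x, hx⟩ fun h => hxa (congrArg Subtype.val h)
    have h4 : ∑ i with x i = 1, (π.coordMean θ T i)⁻¹ ≤
        ∑ i with x i = 1 ∨ a.1 i = 1, (π.coordMean θ T i)⁻¹ :=
      Finset.sum_le_sum_of_subset_of_nonneg
        (Finset.monotone_filter_right _ fun i _ h => Or.inl h)
        fun i _ _ => inv_nonneg.2 (hpos i).le
    rw [div_mul_eq_mul_div, div_le_iff₀ hs, mul_comm _ s]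
    exact (mul_le_mul_of_nonneg_left h4 hT.le).trans h3
  refine (iInf₂_le τ hτ).trans (EReal.coe_le_coe_iff.2 (le_of_eq ?_))
  have hsup : (⨆ y : 𝒳, y.1 ⬝ᵥ θ) = a.1 ⬝ᵥ θ := by
    have : Nonempty 𝒳 := ⟨a⟩
    refine le_antisymm (ciSup_le fun y => ?_) (dotProduct_le_iSup θ a)
    by_cases hy : y = a
    · rw [hy]
    · exact (hopt y hy).le
  rw [regret_eq_sum, hsup, Finset.sum_div, Finset.mul_sum]
  refine Finset.sum_congr rfl fun x _ => ?_
  rw [gap_eq]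
  show s / Real.log T * π.armMean θ T x * _ = _
  ring

end Policy

end SemiBandit

theorem mainTheorem6 (d : ℕ) (𝒳 : Finset (Fin d → ℝ))
    (h01 : ∀ x ∈ 𝒳, ∀ i, x i = 0 ∨ x i = 1)
    (π : SemiBandit.Policy 𝒳) (hπ : π.Consistent)
    (θ xs : Fin d → ℝ) (hxs : xs ∈ 𝒳)
    (hopt : ∀ x ∈ 𝒳, x ≠ xs → x ⬝ᵥ θ < xs ⬝ᵥ θ)
    (hpull : ∀ᵐ ω ∂(π.law θ), ∀ i, ∃ T, 1 ≤ SemiBandit.pullCount T i ω) :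
    (∀ x ∈ 𝒳,
      limsup (fun T : ℕ =>
          ((Real.log T * SemiBandit.sqNorm (π.designMatrix θ T)⁻¹ x : ℝ) : EReal)) atTop
        ≤ ((SemiBandit.gap θ xs x ^ 2 / 2 : ℝ) : EReal) ∧
      limsup (fun T : ℕ =>
          ((Real.log T * SemiBandit.sqNorm (π.designMatrix θ T)⁻¹ (x - xs) : ℝ) : EReal)) atTop
        ≤ ((SemiBandit.gap θ xs x ^ 2 / 2 : ℝ) : EReal)) ∧
    SemiBandit.lowerBoundConst 𝒳 θ xs
      ≤ limsup (fun T : ℕ => ((π.regret θ T / Real.log T : ℝ) : EReal)) atTop := by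
  classical
  let a : 𝒳 := ⟨xs, hxs⟩
  have hopt' : ∀ x : 𝒳, x ≠ a → x.1 ⬝ᵥ θ < a.1 ⬝ᵥ θ := fun x hx =>
    hopt x.1 x.2 fun h => hx (Subtype.ext h)
  have hpos := SemiBandit.Policy.eventually_coordMean_pos π θ hpull
  have hlog : Tendsto (fun T : ℕ => Real.log T) atTop atTop :=
    Real.tendsto_log_atTop.comp tendsto_natCast_atTop_atTop
  have hbound : ∀ x ∈ 𝒳, ∀ v : Fin d → ℝ,
      (∀ i, v i ^ 2 ≤ if x i = 1 ∨ xs i = 1 then 1 else 0) →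
      limsup (fun T : ℕ =>
          ((Real.log T * SemiBandit.sqNorm (π.designMatrix θ T)⁻¹ v : ℝ) : EReal)) atTop
        ≤ ((SemiBandit.gap θ xs x ^ 2 / 2 : ℝ) : EReal) := by
    intro x hx v hv
    refine SemiBandit.EReal_limsup_le_of_forall_gt fun r hr => ?_
    rw [SemiBandit.gap_eq] at hr
    filter_upwards [hπ.eventually_log_mul_sum_union_le h01 θ a ⟨x, hx⟩ hopt' hpos hr, hpos,
      hlog.eventually_ge_atTop 0] with T g1 g2 g3
    exact (mul_le_mul_of_nonneg_left (SemiBandit.Policy.sqNorm_inv_designMatrix_le π h01 θ g2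
      (a := a) (x := ⟨x, hx⟩) hv) g3).trans g1
  refine ⟨fun x hx => ⟨hbound x hx x fun i => ?_, hbound x hx (x - xs) fun i => ?_⟩, ?_⟩
  · rcases h01 x hx i with h | h <;> simp [h]
    split_ifs <;> norm_num
  · rcases h01 x hx i with h | h <;> rcases h01 xs hxs i with h' | h' <;> simp [h, h']
  · by_contra! hcon
    obtain ⟨q, hq1, hq2⟩ := EReal.lt_iff_exists_real_btwn.1 hcon
    obtain ⟨q', hq3, hq4⟩ := EReal.lt_iff_exists_real_btwn.1 hq2
    have hqq : q < q' := EReal.coe_lt_coe_iff.1 hq3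
    have hev := eventually_lt_of_limsup_lt hq1
    -- The norm bounds hold only in the limit. Since `Δ_x > 0` for `x ≠ x_*`, the factor `s > 1`
    -- gives strict slack, and finiteness of `𝒳` makes one `T` work for all arms.
    have hex : ∀ s : ℝ, 1 < s → ∃ T : ℕ, 0 ≤ π.regret θ T / Real.log T ∧
        π.regret θ T / Real.log T < q ∧
        SemiBandit.lowerBoundConst 𝒳 θ xs ≤ ((s * (π.regret θ T / Real.log T) : ℝ) : EReal) := by
      intro s hs
      have hall : ∀ᶠ T : ℕ in atTop, ∀ x : 𝒳, x ≠ a →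
          Real.log T * ∑ i with x.1 i = 1 ∨ a.1 i = 1, (π.coordMean θ T i)⁻¹ ≤
            s * ((a.1 ⬝ᵥ θ - x.1 ⬝ᵥ θ) ^ 2 / 2) := by
        refine eventually_all.2 fun x => ?_
        by_cases hx : x = a
        · exact Eventually.of_forall fun _ h => absurd hx h
        · have hgap := sub_pos.2 (hopt' x hx)
          filter_upwards [hπ.eventually_log_mul_sum_union_le h01 θ a x hopt' hpos
            (lt_mul_of_one_lt_left (by positivity) hs)] with T hT _ using hT
      obtain ⟨T, g1, g2, g3, g4⟩ :=
        (hall.and (hpos.and ((hlog.eventually_gt_atTop 0).and hev))).exists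
      refine ⟨T, div_nonneg ?_ g3.le, EReal.coe_lt_coe_iff.1 g4,
        SemiBandit.Policy.lowerBoundConst_le π θ a hopt' g3 g2 (zero_lt_one.trans hs) g1⟩
      have := SemiBandit.Policy.armMean_mul_le_regret π θ T a a
      rwa [sub_self, mul_zero] at this
    -- Nonnegativity of the regret forces `q > 0`, which makes `s = q' / q` admissible; the
    -- allocation then costs at most `q'`, below the infimum.
    have hq0 : 0 < q := by
      obtain ⟨T, g1, g2, -⟩ := hex 2 one_lt_two
      exact g1.trans_lt g2
    obtain ⟨T, g1, g2, g3⟩ := hex (q' / q) ((one_lt_div hq0).2 hqq)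
    refine absurd (hq4.trans_le g3) (not_lt.2 (EReal.coe_le_coe_iff.2 ?_))
    calc q' / q * (π.regret θ T / Real.log T) ≤ q' / q * q :=
          mul_le_mul_of_nonneg_left g2.le (div_pos (hq0.trans hqq) hq0).le
      _ = q' := div_mul_cancel₀ _ hq0.ne'
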